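/- Let $M$ be a smooth manifold of dimension $2n+1$ with a weak almost-contact metric structure $(f,Q,\xi,\eta,g)$: a $(1,1)$-tensor $f$, a nonsingular $(1,1)$-tensor $Q$, a vector field $\xi$, a $1$-form $\eta$ and a Riemannian metric $g$ on $M$ (all smooth) such that, for all vector fields $X,Y$, $$f^2=-Q+\eta\otimes\xi,\qquad \eta(\xi)=1,\qquad g(fX,fY)=g(X,QY)-\eta(X)\,\eta(Y),\qquad \eta(X)=g(\xi,X).$$ Let $\nabla$ be the Levi-Civita connection of $g$, and let $h=\tfrac12\,\mathcal L_\xi f$, that is, $hX=\tfrac12\big([\xi,fX]-f[\xi,X]\big)$. Assume that the structure is weak quasi-contact metric (weak q.c.m.), that is, $$(\nabla_Xf)Y+(\nabla_{fX}f)fY=2\,g(X,Y)\,\xi-\eta(Y)\big(X+hX+\eta(X)\,\xi\big)$$ for all vector fields $X,Y$, and that $$(\nabla_XQ)Y=0\qquad\text{for all } X,Y\in\ker\eta.$$ If $h$ is self-adjoint with respect to $g$, then $\eta$ is a contact form, that is, $\eta\wedge(d\eta)^n\neq0$ at every point of $M$, and the $2$-form $\Phi(X,Y)=g(X,fY)$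 is closed, $d\Phi=0$. -/

import Mathlib

open Bundle Manifold VectorField
open scoped ContDiff Manifold

set_option linter.unusedSectionVars false

noncomputable section

namespace WeakContact

variable {E : Type*} [NormedAddCommGroup E] [NormedSpace ℝ E] [FiniteDimensional ℝ E]
  {H : Type*} [TopologicalSpace H] {I : ModelWithCorners ℝ E H}
  {M : Type*} [TopologicalSpace M] [ChartedSpace H M] [IsManifold I ∞ M]

variable (g : ContMDiffRiemannianMetric I ∞ E (TangentSpace I : M → Type _))

/-- The function `g(X, Y)` of two vector fields. -/
def metric (X Y : Π x : M, TangentSpace I x) (x : M) : ℝ := g.inner x (X x) (Y x)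

variable {X X' Y Z : Π x : M, TangentSpace I x} {x : M}

theorem mdifferentiableAt_metric (hX : MDiffAt (T% X) x) (hY : MDiffAt (T% Y) x) :
    MDiffAt (metric g X Y) x := by
  have : MDifferentiableAt I (I.prod 𝓘(ℝ)) 
      (fun m ↦ TotalSpace.mk' ℝ (E := Bundle.Trivial M ℝ) m (g.inner m (X m) (Y m))) x := by
    apply MDifferentiableAt.clm_bundle_apply₂ (F₁ := E) (F₂ := E) 
      (E₁ := (TangentSpace I : M → Type _)) (E₂ := (TangentSpace I : M → Type _))
    · exact g.contMDiff.mdifferentiableAt (by simp)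
    · exact hX
    · exact hY
  simp only [mdifferentiableAt_totalSpace] at this
  exact this.2

variable (X Y Z x) in
/-- The right-hand side of the Koszul formula
`X g(Y,Z) + Y g(X,Z) - Z g(X,Y) + g([X,Y],Z) - g([X,Z],Y) - g([Y,Z],X)`. -/
def koszul : ℝ :=
  mvfderiv I (metric g Y Z) x (X x) + mvfderiv I (metric g X Z) x (Y x)
    - mvfderiv I (metric g X Y) x (Z x)
    + g.inner x (mlieBracket I X Y x) (Z x) - g.inner x (mlieBracket I X Z x) (Y x)
    - g.inner x (mlieBracket I Y Z x) (X x)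

theorem metric_smul_left (f : M → ℝ) : metric g (f • X) Y = f * metric g X Y := by
  ext; simp [metric]
theorem metric_smul_right (f : M → ℝ) : metric g X (f • Y) = f * metric g X Y := by
  ext; simp [metric]
theorem metric_add_left : metric g (X + X') Y = metric g X Y + metric g X' Y := by
  ext; simp [metric]
theorem metric_add_right : metric g Y (X + X') = metric g Y X + metric g Y X' := by
  ext; simp [metric]

theorem koszul_tensorial_left (hY : MDiffAt (T% Y) x) (hZ : MDiffAt (T% Z) x) :
    TensorialAt I E (fun X => koszul g X Y Z x) x where
  smul {f X} hf hX := by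
    simp only [koszul, metric_smul_left, mlieBracket_smul_left hf hX,
      mvfderiv_mul hf (mdifferentiableAt_metric g hX hZ),
      mvfderiv_mul hf (mdifferentiableAt_metric g hX hY)]
    simp [metric, g.symm x (X x)]
    ring
  add {X X'} hX hX' := by
    simp only [koszul, metric_add_left, mlieBracket_add_left hX hX',
      mvfderiv_add (mdifferentiableAt_metric g hX hZ) (mdifferentiableAt_metric g hX' hZ),
      mvfderiv_add (mdifferentiableAt_metric g hX hY) (mdifferentiableAt_metric g hX' hY)]
    simp
    ring

theorem koszul_tensorial_right (hX : MDiffAt (T% X) x) (hY : MDiffAt (T% Y) x) :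
    TensorialAt I E (fun Z => koszul g X Y Z x) x where
  smul {f Z} hf hZ := by
    simp only [koszul, metric_smul_right, mlieBracket_smul_right hf hZ,
      mvfderiv_mul hf (mdifferentiableAt_metric g hX hZ),
      mvfderiv_mul hf (mdifferentiableAt_metric g hY hZ)]
    simp [metric, g.symm x (Z x)]
    ring
  add {Z Z'} hZ hZ' := by
    simp only [koszul, metric_add_right, mlieBracket_add_right hZ hZ',
      mvfderiv_add (mdifferentiableAt_metric g hX hZ) (mdifferentiableAt_metric g hX hZ'),
      mvfderiv_add (mdifferentiableAt_metric g hY hZ) (mdifferentiableAt_metric g hY hZ')]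
    simp
    ring


theorem koszul_add (hX : MDiffAt (T% X) x) (hZ : MDiffAt (T% Z) x) {Y Y' : Π x : M, TangentSpace I x}
    (hY : MDiffAt (T% Y) x) (hY' : MDiffAt (T% Y') x) :
    koszul g X (Y + Y') Z x = koszul g X Y Z x + koszul g X Y' Z x := by
  simp only [koszul, metric_add_left, metric_add_right, mlieBracket_add_left hY hY',
    mlieBracket_add_right hY hY',
    mvfderiv_add (mdifferentiableAt_metric g hY hZ) (mdifferentiableAt_metric g hY' hZ),
    mvfderiv_add (mdifferentiableAt_metric g hX hY) (mdifferentiableAt_metric g hX hY')]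
  simp
  ring

theorem koszul_smul {f : M → ℝ} (hf : MDiffAt f x)
    (hX : MDiffAt (T% X) x) (hZ : MDiffAt (T% Z) x) (hY : MDiffAt (T% Y) x) :
    koszul g X (f • Y) Z x = f x * koszul g X Y Z x
      + 2 * (mvfderiv I f x (X x) * g.inner x (Y x) (Z x)) := by
  simp only [koszul, metric_smul_left, metric_smul_right, mlieBracket_smul_left hf hY,
    mlieBracket_smul_right hf hY,
    mvfderiv_mul hf (mdifferentiableAt_metric g hY hZ),
    mvfderiv_mul hf (mdifferentiableAt_metric g hX hY)]
  simp [metric, g.symm x (Y x)]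
  ring

/-- The metric at a point as a bilinear form. -/
def metricForm (x : M) : LinearMap.BilinForm ℝ (TangentSpace I x) :=
  LinearMap.mk₂ ℝ (fun v w => g.inner x v w) (by simp) (by simp) (by simp) (by simp)

theorem metricForm_nondegenerate (x : M) : (metricForm g x).Nondegenerate := by
  constructor
  · intro v hv
    by_contra h
    exact (g.pos x v h).ne' (hv v)
  · intro v hv
    by_contra h
    exact (g.pos x v h).ne' (hv v)

instance (x : M) : FiniteDimensional ℝ (TangentSpace I x) :=
  inferInstanceAs (FiniteDimensional ℝ E)

/-- The Koszul expression as a bilinear form in the values at `x` of `X` and `Z`. -/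
def koszulForm (Y : Π x : M, TangentSpace I x) (x : M) (hY : MDiffAt (T% Y) x) :
    TangentSpace I x →L[ℝ] TangentSpace I x →L[ℝ] ℝ :=
  TensorialAt.mkHom₂ (I := I) (F := E) (F' := E) (fun X Z => koszul g X Y Z x) x
    (fun _ hZ => koszul_tensorial_left g hY hZ) (fun _ hX => koszul_tensorial_right g hX hY)

/-- The vector `v ∈ T_x M` with `g(v, w) = α w` for all `w`. -/
def sharp (x : M) : (TangentSpace I x →L[ℝ] ℝ) →ₗ[ℝ] TangentSpace I x :=
  ((metricForm g x).toDual (metricForm_nondegenerate g x)).symm.toLinearMap ∘ₗ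
    ContinuousLinearMap.coeLM ℝ

theorem inner_sharp (x : M) (α : TangentSpace I x →L[ℝ] ℝ) (w : TangentSpace I x) :
    g.inner x (sharp g x α) w = α w :=
  LinearMap.BilinForm.apply_toDual_symm_apply (hB := metricForm_nondegenerate g x) (α : _ →ₗ[ℝ] ℝ) w

open scoped Classical in
/-- `(∇ Y)_x : T_x M → T_x M`. -/
def leviCivitaFun (Y : Π x : M, TangentSpace I x) (x : M) :
    TangentSpace I x →L[ℝ] TangentSpace I x :=
  if hY : MDiffAt (T% Y) x then
    (1 / 2 : ℝ) • (LinearMap.toContinuousLinearMap (sharp g x)) ∘L koszulForm g Y x hY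
  else 0


theorem inner_leviCivitaFun (hX : MDiffAt (T% X) x) (hY : MDiffAt (T% Y) x)
    (hZ : MDiffAt (T% Z) x) :
    2 * g.inner x (leviCivitaFun g Y x (X x)) (Z x) = koszul g X Y Z x := by
  have h := TensorialAt.mkHom₂_apply (I := I) (F := E) (F' := E)
    (Φ := fun X Z => koszul g X Y Z x) (x := x)
    (fun _ hZ => koszul_tensorial_left g hY hZ) (fun _ hX => koszul_tensorial_right g hX hY) hX hZ
  rw [← h, leviCivitaFun, dif_pos hY]
  simp [inner_sharp, koszulForm]

/-- Two tangent vectors with the same inner products with all differentiable fields agree. -/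
theorem eq_of_inner_eq {v w : TangentSpace I x}
    (h : ∀ Z : Π x : M, TangentSpace I x, MDiffAt (T% Z) x →
      g.inner x v (Z x) = g.inner x w (Z x)) : v = w := by
  have h' := h (FiberBundle.extend E (v - w)) (FiberBundle.mdifferentiableAt_extend ..)
  by_contra hne
  have := g.pos x (v - w) (sub_ne_zero.2 hne)
  simp at h' this
  linarith

/-- The Levi-Civita connection of `g`, defined by the Koszul formula. The value `leviCivita g Y x v`
is `(∇_v Y)(x)`. -/
def leviCivita : CovariantDerivative I E (TangentSpace I : M → Type _) where
  toFun := leviCivitaFun g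
  isCovariantDerivativeOnUniv :=
    { add := by
        intro Y Y' x hY hY' _
        ext v
        refine eq_of_inner_eq g fun Z hZ => ?_
        have hX := FiberBundle.mdifferentiableAt_extend (I := I) E v
        have e : FiberBundle.extend E v x = v := by simp
        have h1 := inner_leviCivitaFun g hX hY hZ
        have h2 := inner_leviCivitaFun g hX hY' hZ
        have h3 := inner_leviCivitaFun g hX (mdifferentiableAt_add_section hY hY') hZ
        rw [koszul_add g hX hZ hY hY', ← h1, ← h2, e] at h3
        simp only [add_apply, map_add]
        linarith
      leibniz := by
        intro Y f x hY hf _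
        ext v
        refine eq_of_inner_eq g fun Z hZ => ?_
        have hX := FiberBundle.mdifferentiableAt_extend (I := I) E v
        have e : FiberBundle.extend E v x = v := by simp
        have h1 := inner_leviCivitaFun g hX hY hZ
        have h3 := inner_leviCivitaFun g hX (hf.smul_section hY) hZ
        rw [koszul_smul g hf hX hZ hY, ← h1, e] at h3
        simp
        linarith }

theorem leviCivita_torsion (hX : MDiffAt (T% X) x) (hY : MDiffAt (T% Y) x) :
    leviCivita g Y x (X x) - leviCivita g X x (Y x) = mlieBracket I X Y x := by
  refine eq_of_inner_eq g fun Z hZ => ?_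
  have h1 : 2 * g.inner x (leviCivita g Y x (X x)) (Z x) = _ := inner_leviCivitaFun g hX hY hZ
  have h2 : 2 * g.inner x (leviCivita g X x (Y x)) (Z x) = _ := inner_leviCivitaFun g hY hX hZ
  have e : metric g X Y = metric g Y X := by ext; exact g.symm ..
  rw [koszul] at h1 h2
  rw [mlieBracket_swap_apply (V := Y)] at h2
  simp at h2 ⊢
  rw [e] at h1
  linarith

theorem leviCivita_metric (hX : MDiffAt (T% X) x) (hY : MDiffAt (T% Y) x)
    (hZ : MDiffAt (T% Z) x) :
    mvfderiv I (metric g Y Z) x (X x) =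
      g.inner x (leviCivita g Y x (X x)) (Z x) + g.inner x (Y x) (leviCivita g Z x (X x)) := by
  have h1 : 2 * g.inner x (leviCivita g Y x (X x)) (Z x) = _ := inner_leviCivitaFun g hX hY hZ
  have h2 : 2 * g.inner x (leviCivita g Z x (X x)) (Y x) = _ := inner_leviCivitaFun g hX hZ hY
  have e : metric g Z Y = metric g Y Z := by ext; exact g.symm ..
  rw [koszul] at h1 h2
  rw [mlieBracket_swap_apply (V := Z) (W := Y), e] at h2
  rw [g.symm x (Y x)]
  simp at h2
  linarith

/-! ### Tensor fields -/

variable (I M) in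
/-- Smooth vector fields. -/
abbrev VectorFieldSec := Cₛ^∞⟮I; E, (TangentSpace I : M → Type _)⟯

variable (I M) in
/-- Smooth `(1,1)`-tensor fields. -/
abbrev EndSec := Cₛ^∞⟮I; E →L[ℝ] E, fun x : M => TangentSpace I x →L[ℝ] TangentSpace I x⟯

variable (I M) in
/-- Smooth 1-forms. -/
abbrev OneForm := Cₛ^∞⟮I; E →L[ℝ] ℝ, fun x : M => TangentSpace I x →L[ℝ] ℝ⟯

/-- The vector field `x ↦ T_x (X x)`. -/
def appVF (T : EndSec I M) (X : Π x : M, TangentSpace I x) (x : M) : TangentSpace I x := T x (X x)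

/-- The function `x ↦ η_x (X x)`. -/
def appForm (η : OneForm I M) (X : Π x : M, TangentSpace I x) (x : M) : ℝ := η x (X x)

theorem mdifferentiableAt_appVF (T : EndSec I M) (hX : MDiffAt (T% X) x) :
    MDiffAt (T% (appVF T X)) x := by
  apply MDifferentiableAt.clm_bundle_apply (F₁ := E) (F₂ := E) 
      (E₁ := (TangentSpace I : M → Type _)) (E₂ := (TangentSpace I : M → Type _))
  · exact T.contMDiff.mdifferentiableAt (by simp)
  · exact hX

theorem mdifferentiableAt_appForm (η : OneForm I M) (hX : MDiffAt (T% X) x) :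
    MDiffAt (appForm η X) x := by
  have : MDifferentiableAt I (I.prod 𝓘(ℝ)) 
      (fun m ↦ TotalSpace.mk' ℝ (E := Bundle.Trivial M ℝ) m (η m (X m))) x := by
    apply MDifferentiableAt.clm_bundle_apply (F₁ := E)
      (E₁ := (TangentSpace I : M → Type _)) 
    · exact η.contMDiff.mdifferentiableAt (by simp)
    · exact hX
  simp only [mdifferentiableAt_totalSpace] at this
  exact this.2


theorem appVF_add (T : EndSec I M) : appVF T (X + X') = appVF T X + appVF T X' := by
  ext; simp [appVF]
theorem appVF_smul (T : EndSec I M) (f : M → ℝ) : appVF T (f • X) = f • appVF T X := by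
  ext; simp [appVF]
theorem appForm_add (η : OneForm I M) : appForm η (X + X') = appForm η X + appForm η X' := by
  ext; simp [appForm]
theorem appForm_smul (η : OneForm I M) (f : M → ℝ) : appForm η (f • X) = f * appForm η X := by
  ext; simp [appForm]

theorem nabla_tensorial (T : EndSec I M) (x : M) :
    TensorialAt I E (fun Y => leviCivita g (appVF T Y) x - T x ∘L leviCivita g Y x) x where
  smul {f Y} hf hY := by
    ext v
    simp only [appVF_smul,
      (leviCivita g).isCovariantDerivativeOn.leibniz (mdifferentiableAt_appVF T hY) hf,
      (leviCivita g).isCovariantDerivativeOn.leibniz hY hf]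
    simp [appVF, smul_sub]
  add {Y Y'} hY hY' := by
    ext v
    simp only [appVF_add,
      (leviCivita g).isCovariantDerivativeOn.add (mdifferentiableAt_appVF T hY)
        (mdifferentiableAt_appVF T hY'),
      (leviCivita g).isCovariantDerivativeOn.add hY hY']
    simp
    abel

/-- The tensor `∇T` of a `(1,1)`-tensor field: `nabla g T x v w` is `(∇_v T) w`, where
`(∇_X T) Y = ∇_X (T Y) - T (∇_X Y)` for vector fields. -/
def nabla (T : EndSec I M) (x : M) (v w : TangentSpace I x) : TangentSpace I x :=
  TensorialAt.mkHom _ x (nabla_tensorial g T x) w v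

theorem nabla_apply (T : EndSec I M) (X : Π x : M, TangentSpace I x) (hY : MDiffAt (T% Y) x) :
    nabla g T x (X x) (Y x) = leviCivita g (appVF T Y) x (X x) - T x (leviCivita g Y x (X x)) := by
  rw [nabla, TensorialAt.mkHom_apply _ hY]
  simp

theorem lie_tensorial (ξ : VectorFieldSec I M) (T : EndSec I M) (x : M) :
    TensorialAt I E (fun X => mlieBracket I ξ (appVF T X) x - T x (mlieBracket I ξ X x)) x where
  smul {f Y} hf hY := by
    simp only [appVF_smul, mlieBracket_smul_right hf (mdifferentiableAt_appVF T hY),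
      mlieBracket_smul_right hf hY]
    simp [appVF, smul_sub]
  add {Y Y'} hY hY' := by
    simp only [appVF_add, mlieBracket_add_right (mdifferentiableAt_appVF T hY)
        (mdifferentiableAt_appVF T hY'), mlieBracket_add_right hY hY']
    simp
    abel

/-- The Lie derivative `ℒ_ξ T` of a `(1,1)`-tensor field, `(ℒ_ξ T) X = [ξ, T X] - T [ξ, X]`. -/
def lieDerivEnd (ξ : VectorFieldSec I M) (T : EndSec I M) (x : M) :
    TangentSpace I x →L[ℝ] TangentSpace I x :=
  TensorialAt.mkHom _ x (lie_tensorial ξ T x)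

theorem lieDerivEnd_apply (ξ : VectorFieldSec I M) (T : EndSec I M) (hX : MDiffAt (T% X) x) :
    lieDerivEnd ξ T x (X x) = mlieBracket I ξ (appVF T X) x - T x (mlieBracket I ξ X x) :=
  TensorialAt.mkHom_apply (lie_tensorial ξ T x) hX

variable (X Y x) in
/-- The value at `x` of `(1/2) (X (η Y) - Y (η X) - η [X, Y])`. -/
def dOneFormAux (η : OneForm I M) : ℝ :=
  (1 / 2) * (mvfderiv I (appForm η Y) x (X x) - mvfderiv I (appForm η X) x (Y x)
    - η x (mlieBracket I X Y x))

theorem dOneFormAux_tensorial_left (η : OneForm I M) (Y : Π x : M, TangentSpace I x) :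
    TensorialAt I E (fun X => dOneFormAux X Y x η) x where
  smul {f X} hf hX := by
    simp only [dOneFormAux, appForm_smul, mlieBracket_smul_left hf hX,
      mvfderiv_mul hf (mdifferentiableAt_appForm η hX)]
    simp [appForm]
    ring
  add {X X'} hX hX' := by
    simp only [dOneFormAux, appForm_add, mlieBracket_add_left hX hX',
      mvfderiv_add (mdifferentiableAt_appForm η hX) (mdifferentiableAt_appForm η hX')]
    simp
    ring

theorem dOneFormAux_tensorial_right (η : OneForm I M) (X : Π x : M, TangentSpace I x) :
    TensorialAt I E (fun Y => dOneFormAux X Y x η) x where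
  smul {f Y} hf hY := by
    simp only [dOneFormAux, appForm_smul, mlieBracket_smul_right hf hY,
      mvfderiv_mul hf (mdifferentiableAt_appForm η hY)]
    simp [appForm]
    ring
  add {Y Y'} hY hY' := by
    simp only [dOneFormAux, appForm_add, mlieBracket_add_right hY hY',
      mvfderiv_add (mdifferentiableAt_appForm η hY) (mdifferentiableAt_appForm η hY')]
    simp
    ring

/-- The exterior derivative of a 1-form, `2 dη(X,Y) = X (η Y) - Y (η X) - η [X, Y]`. -/
def dOneForm (η : OneForm I M) (x : M) : TangentSpace I x →L[ℝ] TangentSpace I x →L[ℝ] ℝ :=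
  TensorialAt.mkHom₂ (I := I) (F := E) (F' := E) (fun X Y => dOneFormAux X Y x η) x
    (fun Y _ => dOneFormAux_tensorial_left η Y) (fun X _ => dOneFormAux_tensorial_right η X)

theorem dOneForm_apply (η : OneForm I M) (hX : MDiffAt (T% X) x) (hY : MDiffAt (T% Y) x) :
    dOneForm η x (X x) (Y x) = (1 / 2) * (mvfderiv I (appForm η Y) x (X x)
      - mvfderiv I (appForm η X) x (Y x) - η x (mlieBracket I X Y x)) :=
  TensorialAt.mkHom₂_apply (I := I) (F := E) (F' := E) (Φ := fun X Y => dOneFormAux X Y x η)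
    (fun Y _ => dOneFormAux_tensorial_left η Y) (fun X _ => dOneFormAux_tensorial_right η X)
    hX hY


variable (X Y Z x) in
/-- The exterior derivative of a 2-form `β`, evaluated on three vector fields:
`3 dβ(X,Y,Z) = X β(Y,Z) + Y β(Z,X) + Z β(X,Y) - β([X,Y],Z) - β([Z,X],Y) - β([Y,Z],X)`. -/
def dTwoForm (β : Π x : M, TangentSpace I x → TangentSpace I x → ℝ) : ℝ :=
  (1 / 3) * (mvfderiv I (fun y => β y (Y y) (Z y)) x (X x)
    + mvfderiv I (fun y => β y (Z y) (X y)) x (Y x)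
    + mvfderiv I (fun y => β y (X y) (Y y)) x (Z x)
    - β x (mlieBracket I X Y x) (Z x) - β x (mlieBracket I Z X x) (Y x)
    - β x (mlieBracket I Y Z x) (X x))

/-- The value `(α ∧ β ∧ ⋯ ∧ β)(v₀, …, v₂ₙ)` (with `n` factors `β`) of the exterior product of a
1-form and `n` copies of a 2-form on a vector space: the antisymmetrization
`1/(2n+1)! ∑_σ sgn(σ) α(v_σ(0)) β(v_σ(1), v_σ(2)) ⋯ β(v_σ(2n-1), v_σ(2n))`. -/
def wedgePow {V : Type*} (α : V → ℝ) (β : V → V → ℝ) (n : ℕ) (v : Fin (2 * n + 1) → V) : ℝ :=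
  ((2 * n + 1).factorial : ℝ)⁻¹ * ∑ σ : Equiv.Perm (Fin (2 * n + 1)),
    ((Equiv.Perm.sign σ : ℤ) : ℝ) * (α (v (σ 0)) *
      ∏ i : Fin n, β (v (σ ⟨2 * i + 1, by omega⟩)) (v (σ ⟨2 * i + 2, by omega⟩)))

/-- `η` is a contact form on a manifold of dimension `2n+1`: the form `η ∧ (dη)ⁿ` is nonzero at
every point. -/
def IsContactForm (n : ℕ) (η : OneForm I M) : Prop :=
  ∀ x : M, ∃ v : Fin (2 * n + 1) → TangentSpace I x,
    wedgePow (fun a => η x a) (fun a b => dOneForm η x a b) n v ≠ 0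

variable (I M) in
/-- A weak almost-contact metric structure `(f, Q, ξ, η, g)`. -/
structure WeakACMStructure where
  f : EndSec I M
  Q : EndSec I M
  ξ : VectorFieldSec I M
  η : OneForm I M
  g : ContMDiffRiemannianMetric I ∞ E (TangentSpace I : M → Type _)
  Q_nonsingular : ∀ x, Function.Bijective (Q x)
  f_sq : ∀ (x : M) (X : TangentSpace I x), f x (f x X) = -Q x X + η x X • ξ x
  η_ξ : ∀ x, η x (ξ x) = 1
  metric_f : ∀ (x : M) (X Y : TangentSpace I x),
    g.inner x (f x X) (f x Y) = g.inner x X (Q x Y) - η x X * η x Y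
  η_eq : ∀ (x : M) (X : TangentSpace I x), η x X = g.inner x (ξ x) X

namespace WeakACMStructure

variable (S : WeakACMStructure I M)

/-- The tensor `h = (1/2) ℒ_ξ f`. -/
def h (x : M) : TangentSpace I x →L[ℝ] TangentSpace I x := (1 / 2 : ℝ) • lieDerivEnd S.ξ S.f x

/-- The fundamental 2-form `Φ(X, Y) = g(X, f Y)`. -/
def Φ (x : M) (X Y : TangentSpace I x) : ℝ := S.g.inner x X (S.f x Y)

/-- The structure is weak quasi-contact metric:
`(∇_X f)Y + (∇_{fX} f)fY = 2 g(X,Y) ξ - η(Y) (X + hX + η(X) ξ)`. -/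
def IsQuasiContact : Prop :=
  ∀ (x : M) (X Y : TangentSpace I x),
    nabla S.g S.f x X Y + nabla S.g S.f x (S.f x X) (S.f x Y) =
      (2 * S.g.inner x X Y) • S.ξ x - S.η x Y • (X + S.h x X + S.η x X • S.ξ x)

/-- The tensor `h` is self-adjoint with respect to `g`. -/
def IsSelfAdjointH : Prop :=
  ∀ (x : M) (X Y : TangentSpace I x), S.g.inner x (S.h x X) Y = S.g.inner x X (S.h x Y)

end WeakACMStructure

end WeakContact

end

/-! Everything reduces to the identity `dη = Φ`. It makes `Φ` closed because `d² = 0`, and, together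
with `f² = -id + η ⊗ ξ`, it gives `dη(w, f w) = -|w|²` on `ker η`, so `dη` is nondegenerate there
and `η` is contact.

The identity is linear algebra in one tangent space. Write `B = ∇ξ` and `T v w = (∇_v f) w`. Metric
compatibility and vanishing torsion turn the geometric data into relations between `f`, `h`, `B`,
`T`: each `T v` is skew, `B` takes values in `ker η`, `2h = T ξ - B f + f B`, and `∇Q` is obtained
by differentiating `f² = -Q + η ⊗ ξ`. Odd dimension gives `f ξ = 0`
(`f_xi_eq_zero_of_quasiContact`). In `quasiContact_pointwise` the quasi-contact identity with `X =
ξ` or `Y = ξ` yields `f B = id + h - η ⊗ ξ` and `B f = id - h - η ⊗ ξ`. The `ξ`-component of `∇Q =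
0` yields `f² B = -B`, and these force `f² = -id + η ⊗ ξ`. Self-adjointness of `h` then identifies
`B - Bᵗ` with `-2f`, which is `dη = Φ`. -/

namespace WeakContact

/-! ### Linear algebra -/

section LinearAlgebra

variable {V : Type*} [AddCommGroup V] [Module ℝ V] [FiniteDimensional ℝ V]

/-- A bilinear form which is alternating and nondegenerate on the kernel of a linear form `α`
admits partial symplectic families in `ker α`. -/
theorem exists_symplectic_family (α : V →ₗ[ℝ] ℝ) (Ω : LinearMap.BilinForm ℝ V)
    (halt : Ω.IsAlt) (hnd : ∀ w, α w = 0 → w ≠ 0 → ∃ u, α u = 0 ∧ Ω w u ≠ 0) {n : ℕ}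
    (hdim : 2 * n < Module.finrank ℝ V) :
    ∃ e f : Fin n → V, (∀ i, α (e i) = 0) ∧ (∀ i, α (f i) = 0) ∧
      (∀ i j, Ω (e i) (e j) = 0) ∧ (∀ i j, Ω (f i) (f j) = 0) ∧
      ∀ i j, Ω (e i) (f j) = if i = j then 1 else 0 := by
  have hneg : ∀ x y, - Ω x y = Ω y x := LinearMap.IsAlt.neg halt
  induction n with
  | zero => exact ⟨Fin.elim0, Fin.elim0, by simp⟩
  | succ m ih =>
    obtain ⟨e, f, he, hf, hee, hff, hef⟩ := ih (by omega)
    have hfe : ∀ i j, Ω (f i) (e j) = - if i = j then 1 else 0 := fun i j => by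
      rw [← hneg (e j) (f i), hef]; simp [eq_comm]
    -- The target has dimension `2m + 1`, less than that of `V`, so some nonzero `w` in `ker α` is
    -- `Ω`-orthogonal to the family built so far.
    let L : V →ₗ[ℝ] (ℝ × (Fin m → ℝ)) × (Fin m → ℝ) :=
      (α.prod (LinearMap.pi fun i => Ω (e i))).prod (LinearMap.pi fun i => Ω (f i))
    obtain ⟨w, hw, hw0⟩ : ∃ w, L w = 0 ∧ w ≠ 0 := by
      have : LinearMap.ker L ≠ ⊥ := LinearMap.ker_ne_bot_of_finrank_lt (by simp; omega)
      obtain ⟨w, hw, h0⟩ := Submodule.exists_mem_ne_zero_of_ne_bot this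
      exact ⟨w, hw, h0⟩
    have hαw : α w = 0 := congrArg (fun p => p.1.1) hw
    have hew : ∀ i, Ω (e i) w = 0 := fun i => congrFun (congrArg (fun p => p.1.2) hw) i
    have hfw : ∀ i, Ω (f i) w = 0 := fun i => congrFun (congrArg (fun p => p.2) hw) i
    have hwe : ∀ i, Ω w (e i) = 0 := fun i => by rw [← hneg, hew, neg_zero]
    have hwf : ∀ i, Ω w (f i) = 0 := fun i => by rw [← hneg, hfw, neg_zero]
    obtain ⟨u, hu, hwu⟩ := hnd w hαw hw0
    -- Symplectic Gram–Schmidt: the sum is the projection of `u` to the span of the family. Removing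
    -- it leaves `Ω w u` unchanged, since `w` is orthogonal to that span.
    let u' : V := (Ω w u)⁻¹ • (u - ∑ j, (Ω (e j) u • f j - Ω (f j) u • e j))
    have hαu : α u' = 0 := by simp [u', map_sum, he, hf, hu]
    have hwu' : Ω w u' = 1 := by simp [u', map_sum, hwe, hwf, hwu]
    have heu : ∀ i, Ω (e i) u' = 0 := fun i => by simp [u', map_sum, hee, hef]
    have hfu : ∀ i, Ω (f i) u' = 0 := fun i => by simp [u', map_sum, hff, hfe]
    have hue : ∀ i, Ω u' (e i) = 0 := fun i => by rw [← hneg, heu, neg_zero]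
    have huf : ∀ i, Ω u' (f i) = 0 := fun i => by rw [← hneg, hfu, neg_zero]
    refine ⟨Fin.cons w e, Fin.cons u' f, ?_, ?_, ?_, ?_, ?_⟩
    · exact Fin.cases hαw he
    · exact Fin.cases hαu hf
    · exact Fin.cases (Fin.cases (halt w) hwe) fun i => Fin.cases (hew i) (hee i)
    · exact Fin.cases (Fin.cases (halt u') huf) fun i => Fin.cases (hfu i) (hff i)
    · refine Fin.cases (Fin.cases ?_ fun j => ?_) fun i => Fin.cases ?_ fun j => ?_
      · simpa using hwu'
      · simpa [Ne.symm (Fin.succ_ne_zero j)] using hwf j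
      · simpa using heu i
      · simpa using hef i j

/-- A skew-adjoint endomorphism of an odd-dimensional space has a nonzero kernel. -/
theorem exists_ne_zero_of_skew_of_odd (G : LinearMap.BilinForm ℝ V)
    (hsymm : ∀ v w, G v w = G w v) (hpos : ∀ v, v ≠ 0 → 0 < G v v) (f : V →ₗ[ℝ] V)
    (hf : ∀ v w, G (f v) w = - G v (f w)) (hodd : Odd (Module.finrank ℝ V)) :
    ∃ k, k ≠ 0 ∧ f k = 0 := by
  by_contra! hk
  -- With trivial kernel, `Ω v (f v) = |f v|² > 0` makes `Ω` nondegenerate, but a skew matrix of odd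
  -- size has determinant zero.
  let Ω : LinearMap.BilinForm ℝ V := G ∘ₗ f
  have hΩsep : Ω.SeparatingLeft := fun v hv => by
    by_contra hv0
    exact (hpos _ (hk v hv0)).ne' (hv (f v))
  let b := Module.finBasis ℝ V
  have hdet := (LinearMap.separatingLeft_iff_det_ne_zero b).1 hΩsep
  have htr : (LinearMap.toMatrix₂ b b Ω).transpose = - LinearMap.toMatrix₂ b b Ω := by
    ext i j
    simp [LinearMap.toMatrix₂_apply, Ω, hf (b i), hsymm (b i)]
  have := congrArg Matrix.det htr
  rw [Matrix.det_transpose, Matrix.det_neg, Fintype.card_fin, hodd.neg_one_pow] at this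
  exact hdet (by linarith)

/-- If `g(fX, fY) = - g(X, f²Y)` then `f` is skew-adjoint. -/
theorem skew_of_inner_map_map (G : LinearMap.BilinForm ℝ V)
    (hsymm : ∀ v w, G v w = G w v) (hpos : ∀ v, v ≠ 0 → 0 < G v v) (f : V →ₗ[ℝ] V)
    (hf : ∀ v w, G (f v) (f w) = - G v (f (f w))) (v w : V) : G (f v) w = - G v (f w) := by
  -- The hypothesis gives skewness only against vectors of the range. Splitting `V` as kernel plus
  -- range reduces the rest to orthogonality of `ker f` and the range of `f²`.
  have hdisj : Disjoint (LinearMap.ker f) (LinearMap.range f) := by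
    rw [Submodule.disjoint_def]
    rintro _ hx ⟨y, rfl⟩
    by_contra h0
    have h1 := hpos _ h0
    rw [hf, LinearMap.mem_ker.1 hx] at h1
    simp at h1
  have hcompl : LinearMap.ker f ⊔ LinearMap.range f = ⊤ := by
    refine Submodule.eq_top_of_disjoint _ _ ?_ hdisj
    rw [add_comm, LinearMap.finrank_range_add_finrank_ker]
  have hdec : ∀ x : V, ∃ k y, f k = 0 ∧ x = k + f y := fun x => by
    obtain ⟨k, hk, _, ⟨y, rfl⟩, h⟩ := Submodule.mem_sup.1 (hcompl ▸ Submodule.mem_top : x ∈ _)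
    exact ⟨k, y, hk, h.symm⟩
  obtain ⟨k, y, hk, rfl⟩ := hdec v
  obtain ⟨l, z, hl, rfl⟩ := hdec w
  have h1 := hf k z
  have h2 := hf l y
  have h3 := hf (f y) z
  simp only [hk, hl, map_zero, LinearMap.zero_apply, map_add, LinearMap.add_apply, zero_add] at *
  rw [hsymm] at h2
  linarith

end LinearAlgebra

/-! ### The top exterior power of a symplectic family -/

/-- A permutation of `Option (Fin n × Bool)` contributes a nonnegative term to the Pfaffian-type sum
of the standard symplectic form. -/
theorem sign_mul_prod_nonneg {n : ℕ} {A : Option (Fin n × Bool) → ℝ}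
    {B : Option (Fin n × Bool) → Option (Fin n × Bool) → ℝ} (hA0 : A none = 1)
    (hA : ∀ p, A (some p) = 0)
    (hB : ∀ i j b c, B (some (i, b)) (some (j, c)) =
      if i = j then (if b = c then 0 else if b then -1 else 1) else 0)
    (τ : Equiv.Perm (Option (Fin n × Bool))) :
    0 ≤ ((Equiv.Perm.sign τ : ℤ) : ℝ) *
      (A (τ none) * ∏ i, B (τ (some (i, false))) (τ (some (i, true)))) := by
  rcases hτ : τ none with _ | p
  swap
  · simp [hA]
  -- Only permutations fixing `none` survive the factor `A`, and they come from permutations of the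
  -- pairs.
  obtain ⟨ρ, hsome⟩ : ∃ ρ : Equiv.Perm (Fin n × Bool), ∀ p, τ (some p) = some (ρ p) := by
    refine ⟨Equiv.removeNone τ, fun p => ?_⟩
    rcases h : τ (some p) with _ | q
    · exact absurd (τ.injective (h.trans hτ.symm)) (by simp)
    · rw [Equiv.removeNone_some _ ⟨q, h⟩, h]
  have hτρ : τ = Equiv.optionCongr ρ := by
    ext1 x
    cases x with
    | none => simpa using hτ
    | some p => simpa using hsome p
  have hsign : Equiv.Perm.sign τ = Equiv.Perm.sign ρ := by rw [hτρ, Equiv.optionCongr_sign]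
  simp only [hA0, one_mul, hsome, hsign]
  by_cases hne : ∀ i, B (some (ρ (i, false))) (some (ρ (i, true))) ≠ 0
  swap
  · push Not at hne
    obtain ⟨i, hi⟩ := hne
    rw [Finset.prod_eq_zero (Finset.mem_univ i) hi, mul_zero]
  have hBρ : ∀ i, B (some (ρ (i, false))) (some (ρ (i, true))) =
      if (ρ (i, false)).1 = (ρ (i, true)).1 then
        (if (ρ (i, false)).2 = (ρ (i, true)).2 then 0 else if (ρ (i, false)).2 then -1 else 1)
      else 0 := fun i => hB _ _ _ _
  -- A nonzero product forces `ρ` to carry each pair `(i, ·)` onto a whole pair: a permutation `P`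
  -- of the indices combined with flips `d i`.
  have h1 : ∀ i, (ρ (i, true)).1 = (ρ (i, false)).1 := fun i => by
    by_contra h
    exact hne i ((hBρ i).trans (if_neg (Ne.symm h)))
  have h2 : ∀ i, (ρ (i, true)).2 = !(ρ (i, false)).2 := fun i => by
    by_contra h
    refine hne i ((hBρ i).trans ?_)
    rw [if_pos (h1 i).symm]
    revert h
    cases (ρ (i, true)).2 <;> cases (ρ (i, false)).2 <;> simp
  -- The images of `(i, false)` and `(i, true)` exhaust their pair, so one of them is `ρ (j,
  -- false)`.
  have hinj : Function.Injective fun i => (ρ (i, false)).1 := fun i j hij => by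
    have key : ∀ b, ρ (i, b) = ρ (j, false) → i = j := fun b h =>
      congrArg Prod.fst (ρ.injective h)
    by_cases hb : (ρ (i, false)).2 = (ρ (j, false)).2
    · exact key false (Prod.ext hij hb)
    · refine key true (Prod.ext ((h1 i).trans hij) ?_)
      rw [h2]
      revert hb
      cases (ρ (i, false)).2 <;> cases (ρ (j, false)).2 <;> simp
  let P : Equiv.Perm (Fin n) := Equiv.ofBijective _ (Finite.injective_iff_bijective.1 hinj)
  let d : Fin n → Equiv.Perm Bool := fun i =>
    if (ρ (i, false)).2 then Equiv.swap false true else 1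
  have hρ' : ρ = (Equiv.prodCongrLeft fun _ : Bool => P) * Equiv.prodCongrRight d := by
    ext1 ⟨i, b⟩
    have hd : d i b = (ρ (i, b)).2 := by
      cases hb : (ρ (i, false)).2 <;> cases b <;> simp [d, hb, h2]
    have hP : P i = (ρ (i, b)).1 := by
      cases b
      · rfl
      · exact (h1 i).symm
    simp [hd, hP]
  -- `P` acts on two copies of `Fin n` and contributes `sign(P)² = 1`. Each remaining flip sign is
  -- cancelled by the sign of the matching `B` factor.
  have hsρ : ((Equiv.Perm.sign ρ : ℤ) : ℝ) = ∏ i, ((Equiv.Perm.sign (d i) : ℤ) : ℝ) := by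
    rw [hρ', map_mul, Equiv.Perm.sign_prodCongrLeft, Equiv.Perm.sign_prodCongrRight]
    rcases Int.units_eq_one_or (Equiv.Perm.sign P) with h | h <;> simp [h]
  rw [hsρ, ← Finset.prod_mul_distrib]
  refine Finset.prod_nonneg fun i _ => ?_
  rw [hBρ]
  cases hb : (ρ (i, false)).2 <;> simp [d, hb, h1, h2]

/-- The enumeration of `Option (Fin n × Bool)` that lists `none` first and then the pairs. -/
noncomputable def finEquivOption (n : ℕ) : Option (Fin n × Bool) ≃ Fin (2 * n + 1) :=
  Equiv.ofBijective
    (fun o => o.elim 0 fun p => ⟨2 * p.1 + (if p.2 then 2 else 1), by split_ifs <;> omega⟩) <| by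
    rw [Fintype.bijective_iff_injective_and_card]
    constructor
    · rintro (_ | ⟨i, b⟩) (_ | ⟨j, c⟩) h
      · rfl
      · have := congrArg Fin.val h; cases c <;> simp at this
      · have := congrArg Fin.val h; cases b <;> simp at this
      · have := congrArg Fin.val h
        cases b <;> cases c <;> simp [Fin.ext_iff] at this ⊢ <;> omega
    · simp; ring

/-- `α ∧ βⁿ` is nonzero on a family consisting of a vector `ξ` with `α ξ = 1` and a symplectic
family of `β` in `ker α`. -/
theorem exists_wedgePow_ne_zero {V : Type*} {α : V → ℝ} {β : V → V → ℝ} {n : ℕ} {ξ : V}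
    {e f : Fin n → V} (hξ : α ξ = 1) (he : ∀ i, α (e i) = 0) (hf : ∀ i, α (f i) = 0)
    (hee : ∀ i j, β (e i) (e j) = 0) (hff : ∀ i j, β (f i) (f j) = 0)
    (hef : ∀ i j, β (e i) (f j) = if i = j then 1 else 0)
    (hfe : ∀ i j, β (f i) (e j) = if i = j then -1 else 0) :
    ∃ v : Fin (2 * n + 1) → V, wedgePow α β n v ≠ 0 := by
  let q := finEquivOption n
  let w : Option (Fin n × Bool) → V := fun o => o.elim ξ fun p => if p.2 then f p.1 else e p.1
  have hq0 : q.symm 0 = none := (Equiv.symm_apply_eq _).2 rfl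
  have hq1 : ∀ i : Fin n, q.symm ⟨2 * i + 1, by omega⟩ = some (i, false) :=
    fun i => (Equiv.symm_apply_eq _).2 rfl
  have hq2 : ∀ i : Fin n, q.symm ⟨2 * i + 2, by omega⟩ = some (i, true) :=
    fun i => (Equiv.symm_apply_eq _).2 rfl
  have hB : ∀ i j b c, β (w (some (i, b))) (w (some (j, c))) =
      if i = j then (if b = c then 0 else if b then -1 else 1) else 0 := fun i j b c => by
    cases b <;> cases c <;> simp [w, hee, hff, hef, hfe]
  -- No cancellation can occur: every term is nonnegative and the identity contributes `1`.
  refine ⟨w ∘ q.symm, (mul_pos (by positivity) (Finset.sum_pos' (fun σ _ => ?_)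
    ⟨1, Finset.mem_univ _, ?_⟩)).ne'⟩
  · have h := sign_mul_prod_nonneg (A := fun o => α (w o)) (B := fun o o' => β (w o) (w o'))
      hξ (fun p => by rcases p with ⟨i, _ | _⟩ <;> simp [w, he, hf]) hB (q.symm.permCongr σ)
    rw [Equiv.Perm.sign_permCongr] at h
    simpa only [Function.comp_apply, Equiv.permCongr_apply, Equiv.symm_symm, ← hq0, ← hq1, ← hq2,
      Equiv.apply_symm_apply] using h
  · have : ∀ i : Fin n, β (w (some (i, false))) (w (some (i, true))) = 1 := fun i => by simp [hB]
    simp only [Equiv.Perm.sign_one, Equiv.Perm.one_apply, Function.comp_apply, hq0, hq1, hq2, this]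
    simp [w, hξ]

/-! ### Pointwise algebra of weak quasi-contact structures -/

section Pointwise

variable {V : Type*} [AddCommGroup V] [Module ℝ V] [FiniteDimensional ℝ V]
  {G : LinearMap.BilinForm ℝ V} {f h B : V →ₗ[ℝ] V} {T : V → V → V} {ξ : V}

theorem eq_zero_of_forall_inner_eq_zero (hpos : ∀ v, v ≠ 0 → 0 < G v v) {v : V}
    (hv : ∀ w, G v w = 0) : v = 0 := by
  by_contra h0
  exact (hpos v h0).ne' (hv v)

/-- In an odd-dimensional space, a quasi-contact structure satisfies `f ξ = 0`. -/
theorem f_xi_eq_zero_of_quasiContact (hsymm : ∀ v w, G v w = G w v)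
    (hpos : ∀ v, v ≠ 0 → 0 < G v v) (hodd : Odd (Module.finrank ℝ V)) (hξ : G ξ ξ = 1)
    (hf : ∀ v w, G (f v) w = - G v (f w))
    (hT : ∀ v w u, G (T v w) u = - G w (T v u)) (hT0 : ∀ w, T 0 w = 0)
    (hqc : ∀ X Y, T X Y + T (f X) (f Y) =
      (2 * G X Y) • ξ - G ξ Y • (X + h X + G ξ X • ξ))
    (h2 : ∀ v, (2 : ℝ) • h v = T ξ v - B (f v) + f (B v)) : f ξ = 0 := by
  obtain ⟨k, hk0, hk⟩ := exists_ne_zero_of_skew_of_odd G hsymm hpos f hf hodd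
  have hTself : ∀ v w, G (T v w) w = 0 := fun v w => by
    have := hT v w w; rw [hsymm w] at this; linarith
  -- Setting `X = k` kills the second term of the identity. Pairing with `Y` then kills the first as
  -- well, since `T k` is skew, leaving `η(Y) g(z, Y) = 0`. The choices `Y = ξ` and `Y = ξ + z` give
  -- `z = 0`.
  set z := k - h k - G ξ k • ξ with hz
  have hz1 : ∀ Y, G ξ Y * G z Y = 0 := fun Y => by
    have := congrArg (fun u => G u Y) (hqc k Y)
    simp only [hk, hT0, add_zero, hTself, map_sub, map_smul, map_add, LinearMap.sub_apply,
      LinearMap.smul_apply, LinearMap.add_apply, smul_eq_mul] at this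
    simp only [hz, map_sub, map_smul, LinearMap.sub_apply, LinearMap.smul_apply, smul_eq_mul]
    linear_combination -this
  have hzξ : G z ξ = 0 := by simpa [hξ] using hz1 ξ
  have hz0 : z = 0 := by
    by_contra h0
    have h1 := hz1 (ξ + z)
    simp only [map_add, hξ, hzξ, hsymm ξ z, add_zero, zero_add, one_mul] at h1
    exact (hpos z h0).ne' h1
  -- In the formula for `2h` each term pairs to zero with `k`, by skewness and `f k = 0`. With `z =
  -- 0` this gives `|k|² = η(k)²`, the equality case of Cauchy–Schwarz, so `k` is a multiple of `ξ`.
  have hhk : G (h k) k = 0 := by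
    have := congrArg (fun u => G u k) (h2 k)
    simp only [hk, map_zero, sub_zero, map_add, map_smul, LinearMap.add_apply,
      LinearMap.smul_apply, smul_eq_mul, hTself, hf, neg_zero, add_zero] at this
    linarith
  have hkk : G k k = G ξ k * G ξ k := by
    have := congrArg (fun u => G u k) hz0
    simp only [hz, map_sub, map_smul, LinearMap.sub_apply, LinearMap.smul_apply, smul_eq_mul, hhk,
      map_zero, LinearMap.zero_apply] at this
    linarith
  have hkξ : k = G ξ k • ξ := by
    by_contra h0
    have := hpos _ (sub_ne_zero.2 h0)
    simp only [map_sub, map_smul, LinearMap.sub_apply, LinearMap.smul_apply, smul_eq_mul, hξ,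
      hsymm k ξ, hkk] at this
    linarith
  have hne : G ξ k ≠ 0 := fun h0 => hk0 (by rw [hkξ, h0, zero_smul])
  rw [hkξ, map_smul] at hk
  exact (smul_eq_zero.1 hk).resolve_left hne

/-- The algebraic consequences of the quasi-contact identity and of `∇Q = 0` on `ker η`:
`f² = - id + η ⊗ ξ`, and `∇ξ` has skew part `- f`. -/
theorem quasiContact_pointwise {Q : V →ₗ[ℝ] V} (hsymm : ∀ v w, G v w = G w v)
    (hpos : ∀ v, v ≠ 0 → 0 < G v v) (hξ : G ξ ξ = 1)
    (hf : ∀ v w, G (f v) w = - G v (f w)) (hfξ : f ξ = 0)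
    (hQ : Function.Injective Q) (hsq : ∀ v, f (f v) = - Q v + G ξ v • ξ)
    (hT : ∀ v w u, G (T v w) u = - G w (T v u)) (hT0 : ∀ w, T 0 w = 0)
    (hTξ : ∀ v, T v ξ = - f (B v)) (hBξ : ∀ v, G ξ (B v) = 0)
    (hqc : ∀ X Y, T X Y + T (f X) (f Y) =
      (2 * G X Y) • ξ - G ξ Y • (X + h X + G ξ X • ξ))
    (h2 : ∀ v, (2 : ℝ) • h v = T ξ v - B (f v) + f (B v))
    (hh : ∀ v w, G (h v) w = G v (h w))
    (hnQ : ∀ v w, G ξ v = 0 → G ξ w = 0 →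
      - T v (f w) - f (T v w) + G (B v) w • ξ + G ξ w • B v = 0) :
    (∀ v, f (f v) = - v + G ξ v • ξ) ∧ ∀ v w, G (B v) w - G v (B w) = 2 * G v (f w) := by
  have hξf : ∀ v, G ξ (f v) = 0 := fun v => by
    have := hf ξ v; rw [hfξ] at this; simpa using this.symm
  have hTv0 : ∀ v, T v 0 = 0 := fun v =>
    eq_zero_of_forall_inner_eq_zero hpos fun w => by rw [hT]; simp
  have hhξ : h ξ = 0 := by
    have := h2 ξ
    rw [hTξ, hfξ, map_zero, sub_zero, neg_add_cancel] at this
    exact (smul_eq_zero.1 this).resolve_left two_ne_zero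
  -- The identity with `X = ξ`; `Y = ξ` gives `hfB` next.
  have hTξ0 : ∀ v, T ξ v = 0 := fun v => by
    have := hqc ξ v
    rw [hfξ, hT0, hhξ, hξ] at this
    rw [← add_zero (T ξ v), this]
    module
  have hfB : ∀ v, f (B v) = v + h v - G ξ v • ξ := fun v => by
    have := hqc v ξ
    rw [hfξ, hTv0, hξ, hTξ, hsymm v ξ] at this
    rw [← neg_inj, ← add_zero (-f (B v)), this]
    module
  have hBf : ∀ v, B (f v) = v - h v - G ξ v • ξ := fun v => by
    have h1 := h2 v
    rw [hTξ0, hfB] at h1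
    have : B (f v) = (v + h v - G ξ v • ξ) - (2 : ℝ) • h v := by rw [h1]; abel
    rw [this]
    module
  -- Nonsingularity of `Q` enters here: `f (B ξ) = 0` and `η (B ξ) = 0` give `Q (B ξ) = 0`.
  have hBξ0 : B ξ = 0 := by
    have h1 : f (B ξ) = 0 := by rw [hfB, hhξ, hξ]; simp
    have h3 := hsq (B ξ)
    rw [h1, hBξ] at h3
    exact hQ (by simpa using h3.symm)
  -- Only the `ξ`-component of `∇Q = 0` is needed: `g(B v, w) = η(T v (f w))`, and skewness of `T v`
  -- with `T v ξ = -f (B v)` turns the right side into `-g(f² B v, w)`.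
  have hffB0 : ∀ v, G ξ v = 0 → f (f (B v)) = - B v := fun v hv => by
    rw [← sub_eq_zero, sub_neg_eq_add]
    refine eq_zero_of_forall_inner_eq_zero hpos fun w => ?_
    have key : ∀ w, G ξ w = 0 → G (f (f (B v)) + B v) w = 0 := fun w hw => by
      have h1 := congrArg (G ξ) (hnQ v w hv hw)
      simp only [map_add, map_sub, map_neg, map_smul, map_zero, hξf, hBξ, hξ, smul_eq_mul] at h1
      have h3 := hT v (f w) ξ
      rw [hTξ, hsymm, map_neg, hf w, hsymm w] at h3
      rw [map_add, LinearMap.add_apply]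
      linarith
    have h1 := key (w - G ξ w • ξ) (by simp [hξ])
    have h3 : G (f (f (B v)) + B v) ξ = 0 := by rw [hsymm]; simp [hξf, hBξ]
    rw [map_sub, map_smul, h3] at h1
    simpa using h1
  have hffB : ∀ v, f (f (B v)) = - B v := fun v => by
    have := hffB0 (v - G ξ v • ξ) (by simp [hξ])
    simpa [hBξ0] using this
  -- `f² = -id` holds on the range of `B`, hence on those of `f B` and `B f`; adding the two
  -- relations cancels the terms `f² h`.
  have hff : ∀ v, f (f v) = - v + G ξ v • ξ := fun v => by
    have h1 := congrArg f (hffB v)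
    have h3 := hffB (f v)
    rw [hfB] at h1
    rw [map_neg, hfB] at h1
    rw [hBf] at h3
    simp only [map_add, map_sub, map_smul, hfξ, smul_zero, sub_zero] at h1 h3
    have : (2 : ℝ) • f (f v) = (2 : ℝ) • (- v + G ξ v • ξ) := by
      calc (2 : ℝ) • f (f v) = (f (f v) + f (f (h v))) + (f (f v) - f (f (h v))) := by module
        _ = _ := by rw [h1, h3]; module
    exact smul_right_injective V two_ne_zero this
  refine ⟨hff, fun v w => ?_⟩
  have hfh : f (h w) = - B w - f w := by
    have h1 : h w = f (B w) - w + G ξ w • ξ := by rw [hfB]; module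
    rw [h1]
    simp only [map_add, map_sub, map_smul, hfξ, hffB, smul_zero, add_zero]
  have hhf : h (f w) = f w + B w := by
    have h1 := hBf (f w)
    rw [hff, hξf, map_add, map_neg, map_smul, hBξ0] at h1
    have h3 : h (f w) = f w - (-B w + G ξ w • (0 : V)) - (0 : ℝ) • ξ := by rw [h1]; module
    rw [h3]
    module
  -- This is `g(f B v, f w)` computed in two ways. Moving `h` across by self-adjointness and using
  -- `h f = f + B` finishes.
  have e1 : G (B v) w = G v (f w) + G (h v) (f w) := by
    have h1 := hf (B v) (f w)
    rw [hff, hfB, map_add, map_neg, map_smul, hsymm _ ξ, hBξ] at h1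
    simp only [map_add, map_sub, map_smul, LinearMap.add_apply, LinearMap.sub_apply,
      LinearMap.smul_apply, hξf, smul_zero, sub_zero, add_zero, neg_neg] at h1
    exact h1.symm
  rw [e1, hh, hhf, map_add]
  ring

end Pointwise

end WeakContact

namespace WeakContact

/-! ### Derivatives of the structure tensors -/

section Geometry

variable {E : Type*} [NormedAddCommGroup E] [NormedSpace ℝ E] [FiniteDimensional ℝ E]
  {H : Type*} [TopologicalSpace H] {I : ModelWithCorners ℝ E H}
  {M : Type*} [TopologicalSpace M] [ChartedSpace H M] [IsManifold I ∞ M]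
  {X Y Z : Π x : M, TangentSpace I x} {x : M}

theorem nabla_zero_left (g : ContMDiffRiemannianMetric I ∞ E (TangentSpace I : M → Type _))
    (T : EndSec I M) (w : TangentSpace I x) : nabla g T x 0 w = 0 := by
  simp [nabla]

/-- If `T` is skew-adjoint then so is `∇_v T`. -/
theorem nabla_skew (g : ContMDiffRiemannianMetric I ∞ E (TangentSpace I : M → Type _))
    {T : EndSec I M} (hT : ∀ (x : M) (v w : TangentSpace I x),
      g.inner x (T x v) w = - g.inner x v (T x w)) (v w u : TangentSpace I x) :
    g.inner x (nabla g T x v w) u = - g.inner x w (nabla g T x v u) := by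
  -- Both sides depend only on the values at `x`, so the vectors are extended to fields and `g(T W,
  -- U) = -g(W, T U)` is differentiated along `V`.
  obtain ⟨V, hV, rfl⟩ : ∃ V : Π x : M, TangentSpace I x, MDiffAt (T% V) x ∧ V x = v :=
    ⟨_, FiberBundle.mdifferentiableAt_extend (I := I) E v, by simp⟩
  obtain ⟨W, hW, rfl⟩ : ∃ V : Π x : M, TangentSpace I x, MDiffAt (T% V) x ∧ V x = w :=
    ⟨_, FiberBundle.mdifferentiableAt_extend (I := I) E w, by simp⟩
  obtain ⟨U, hU, rfl⟩ : ∃ V : Π x : M, TangentSpace I x, MDiffAt (T% V) x ∧ V x = u :=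
    ⟨_, FiberBundle.mdifferentiableAt_extend (I := I) E u, by simp⟩
  have h1 := leviCivita_metric g hV (mdifferentiableAt_appVF T hW) hU
  have h2 := leviCivita_metric g hV hW (mdifferentiableAt_appVF T hU)
  have e : metric g (appVF T W) U = - metric g W (appVF T U) := by
    ext y; exact hT y _ _
  rw [e, mvfderiv_neg, neg_apply, h2] at h1
  rw [nabla_apply g T V hW, nabla_apply g T V hU]
  have h3 := hT x (leviCivita g W x (V x)) (U x)
  have h4 := hT x (W x) (leviCivita g U x (V x))
  simp only [appVF, map_sub, sub_apply] at *
  linarith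

theorem dOneForm_alt (η : OneForm I M) (v : TangentSpace I x) : dOneForm η x v v = 0 := by
  obtain ⟨V, hV, rfl⟩ : ∃ V : Π x : M, TangentSpace I x, MDiffAt (T% V) x ∧ V x = v :=
    ⟨_, FiberBundle.mdifferentiableAt_extend (I := I) E v, by simp⟩
  rw [dOneForm_apply η hV hV]
  simp

theorem leviCivita_add_apply (g : ContMDiffRiemannianMetric I ∞ E (TangentSpace I : M → Type _))
    (hX : MDiffAt (T% X) x) (hY : MDiffAt (T% Y) x) (v : TangentSpace I x) :
    leviCivita g (X + Y) x v = leviCivita g X x v + leviCivita g Y x v := by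
  rw [(leviCivita g).isCovariantDerivativeOn.add hX hY, add_apply]

theorem leviCivita_smul_apply (g : ContMDiffRiemannianMetric I ∞ E (TangentSpace I : M → Type _))
    {φ : M → ℝ} (hX : MDiffAt (T% X) x) (hφ : MDiffAt φ x) (v : TangentSpace I x) :
    leviCivita g (φ • X) x v = φ x • leviCivita g X x v + mvfderiv I φ x v • X x := by
  rw [(leviCivita g).isCovariantDerivativeOn.leibniz hX hφ]
  simp

namespace WeakACMStructure

variable (S : WeakACMStructure I M)

theorem mdifferentiableAt_ξ (x : M) : MDiffAt (T% (fun y => S.ξ y)) x :=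
  S.ξ.contMDiff.mdifferentiableAt (by simp)

theorem inner_ξ_ξ (x : M) : S.g.inner x (S.ξ x) (S.ξ x) = 1 := by
  rw [← S.η_eq, S.η_ξ]

theorem appForm_η (X : Π x : M, TangentSpace I x) : appForm S.η X = metric S.g S.ξ X := by
  ext y; exact S.η_eq y _

/-- Eliminating `Q` between `metric_f` and `f_sq` leaves `g(fX, fY) = -g(X, f²Y)`. -/
theorem f_skew (x : M) (v w : TangentSpace I x) :
    S.g.inner x (S.f x v) w = - S.g.inner x v (S.f x w) := by
  refine skew_of_inner_map_map (metricForm S.g x) (fun v w => S.g.symm x v w) (S.g.pos x)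
    (S.f x : TangentSpace I x →ₗ[ℝ] TangentSpace I x) (fun v w => ?_) v w
  change S.g.inner x (S.f x v) (S.f x w) = - S.g.inner x v (S.f x (S.f x w))
  rw [S.metric_f, S.f_sq, S.η_eq x v, S.g.symm x (S.ξ x) v]
  simp
  ring

theorem inner_ξ_leviCivita_ξ (v : TangentSpace I x) :
    S.g.inner x (S.ξ x) (leviCivita S.g S.ξ x v) = 0 := by
  obtain ⟨V, hV, rfl⟩ : ∃ V : Π x : M, TangentSpace I x, MDiffAt (T% V) x ∧ V x = v :=
    ⟨_, FiberBundle.mdifferentiableAt_extend (I := I) E v, by simp⟩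
  have h1 := leviCivita_metric S.g hV (S.mdifferentiableAt_ξ x) (S.mdifferentiableAt_ξ x)
  have e : metric S.g S.ξ S.ξ = fun _ => 1 := by ext y; exact S.inner_ξ_ξ y
  rw [e, mvfderiv_const, S.g.symm x _ (S.ξ x)] at h1
  simp only [zero_apply] at h1
  linarith

/-- Vanishing torsion replaces `[ξ, Y]` by `∇_ξ Y - ∇_Y ξ`; the `∇_ξ` terms collect into `∇_ξ f`. -/
theorem two_smul_h (v : TangentSpace I x) :
    (2 : ℝ) • S.h x v = nabla S.g S.f x (S.ξ x) v - leviCivita S.g S.ξ x (S.f x v)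
      + S.f x (leviCivita S.g S.ξ x v) := by
  obtain ⟨V, hV, rfl⟩ : ∃ V : Π x : M, TangentSpace I x, MDiffAt (T% V) x ∧ V x = v :=
    ⟨_, FiberBundle.mdifferentiableAt_extend (I := I) E v, by simp⟩
  have hξ := S.mdifferentiableAt_ξ x
  have e : (2 : ℝ) • S.h x (V x) = lieDerivEnd S.ξ S.f x (V x) := by simp [h]
  rw [e, lieDerivEnd_apply _ _ hV, ← leviCivita_torsion S.g hξ (mdifferentiableAt_appVF S.f hV),
    ← leviCivita_torsion S.g hξ hV, nabla_apply S.g S.f S.ξ hV]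
  simp only [appVF, map_sub]
  abel

theorem nabla_f_ξ (hfξ : ∀ x, S.f x (S.ξ x) = 0) (v : TangentSpace I x) :
    nabla S.g S.f x v (S.ξ x) = - S.f x (leviCivita S.g S.ξ x v) := by
  obtain ⟨V, hV, rfl⟩ : ∃ V : Π x : M, TangentSpace I x, MDiffAt (T% V) x ∧ V x = v :=
    ⟨_, FiberBundle.mdifferentiableAt_extend (I := I) E v, by simp⟩
  rw [nabla_apply S.g S.f V (S.mdifferentiableAt_ξ x)]
  have e : appVF S.f S.ξ = 0 := by ext1 y; exact hfξ y
  rw [e, CovariantDerivative.zero]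
  simp

/-- The covariant derivative of `f² + Q = η ⊗ ξ`, with `η = g(ξ, ·)` differentiated by metric
compatibility. -/
theorem nabla_Q (v w : TangentSpace I x) :
    nabla S.g S.Q x v w = - nabla S.g S.f x v (S.f x w) - S.f x (nabla S.g S.f x v w)
      + S.g.inner x (leviCivita S.g S.ξ x v) w • S.ξ x
      + S.g.inner x (S.ξ x) w • leviCivita S.g S.ξ x v := by
  obtain ⟨V, hV, rfl⟩ : ∃ V : Π x : M, TangentSpace I x, MDiffAt (T% V) x ∧ V x = v :=
    ⟨_, FiberBundle.mdifferentiableAt_extend (I := I) E v, by simp⟩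
  obtain ⟨W, hW, rfl⟩ : ∃ V : Π x : M, TangentSpace I x, MDiffAt (T% V) x ∧ V x = w :=
    ⟨_, FiberBundle.mdifferentiableAt_extend (I := I) E w, by simp⟩
  have hξ := S.mdifferentiableAt_ξ x
  have hfW := mdifferentiableAt_appVF S.f hW
  have hffW := mdifferentiableAt_appVF S.f hfW
  have hQW := mdifferentiableAt_appVF S.Q hW
  have e : appVF S.f (appVF S.f W) + appVF S.Q W = metric S.g S.ξ W • fun y => S.ξ y := by
    ext1 y
    simp [appVF, S.f_sq, metric, S.η_eq]
  have hm := mdifferentiableAt_metric S.g hξ hW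
  have h1 : leviCivita S.g (appVF S.f (appVF S.f W)) x (V x)
      + leviCivita S.g (appVF S.Q W) x (V x) =
      metric S.g S.ξ W x • leviCivita S.g S.ξ x (V x)
        + mvfderiv I (metric S.g S.ξ W) x (V x) • S.ξ x := by
    rw [← leviCivita_add_apply S.g hffW hQW, e, leviCivita_smul_apply S.g hξ hm]
  rw [leviCivita_metric S.g hV hξ hW] at h1
  have h2 := S.f_sq x (leviCivita S.g W x (V x))
  rw [S.η_eq] at h2
  have e2 := nabla_apply S.g S.f V hfW
  change nabla S.g S.f x (V x) (S.f x (W x)) = _ at e2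
  have e3 := nabla_apply S.g S.f V hW
  have e5 := nabla_apply S.g S.Q V hW
  rw [e2, e3, e5, map_sub, eq_sub_of_add_eq' h1, h2]
  simp only [metric]
  module

/-- Metric compatibility expands the derivatives of `g(ξ, ·)`, and vanishing torsion cancels every
term not containing `∇ξ`. -/
theorem dOneForm_η (v w : TangentSpace I x) :
    dOneForm S.η x v w = (1 / 2) * (S.g.inner x (leviCivita S.g S.ξ x v) w
      - S.g.inner x v (leviCivita S.g S.ξ x w)) := by
  obtain ⟨V, hV, rfl⟩ : ∃ V : Π x : M, TangentSpace I x, MDiffAt (T% V) x ∧ V x = v :=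
    ⟨_, FiberBundle.mdifferentiableAt_extend (I := I) E v, by simp⟩
  obtain ⟨W, hW, rfl⟩ : ∃ V : Π x : M, TangentSpace I x, MDiffAt (T% V) x ∧ V x = w :=
    ⟨_, FiberBundle.mdifferentiableAt_extend (I := I) E w, by simp⟩
  have hξ := S.mdifferentiableAt_ξ x
  rw [dOneForm_apply S.η hV hW, S.appForm_η, S.appForm_η, leviCivita_metric S.g hV hξ hW,
    leviCivita_metric S.g hW hξ hV, ← leviCivita_torsion S.g hV hW, S.η_eq, map_sub,
    S.g.symm x _ (V x)]
  ring

end WeakACMStructure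

/-! ### The exterior derivative squares to zero -/

/-- A smooth function multiplied by a smooth vector field. -/
theorem contMDiff_smul_vectorField {φ : M → ℝ} (hφ : ContMDiff I 𝓘(ℝ) ∞ φ)
    (Z : VectorFieldSec I M) : CMDiff ∞ (T% (φ • (Z : Π x : M, TangentSpace I x))) :=
  hφ.smul_section Z.contMDiff

theorem isManifold_minSmoothness (k : ℕ∞) :
    IsManifold I (minSmoothness ℝ k) M := by
  rw [minSmoothness_of_isRCLikeNormedField]
  exact IsManifold.of_le (n := ∞) (by exact_mod_cast le_top)

theorem contMDiff_mlieBracket (hX : CMDiff ∞ (T% X)) (hY : CMDiff ∞ (T% Y)) :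
    CMDiff ∞ (T% (mlieBracket I X Y)) := by
  have := isManifold_minSmoothness (I := I) (M := M) 2
  have := isManifold_minSmoothness (I := I) (M := M) 3
  have : IsManifold I ((⊤ : ℕ∞) + 1) M := by simpa using ‹IsManifold I ∞ M›
  exact ContDiff.mlieBracket_vectorField (m := ⊤) (n := ⊤) hX hY (by simp)

theorem contMDiff_appForm (η : OneForm I M) (hX : CMDiff ∞ (T% X)) :
    ContMDiff I 𝓘(ℝ) ∞ (appForm η X) := by
  have : ContMDiff I (I.prod 𝓘(ℝ)) ∞
      (fun m ↦ TotalSpace.mk' ℝ (E := Bundle.Trivial M ℝ) m (η m (X m))) := by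
    apply ContMDiff.clm_bundle_apply (F₁ := E) (E₁ := (TangentSpace I : M → Type _))
    · exact η.contMDiff
    · exact hX
  intro y
  exact (Bundle.contMDiffAt_totalSpace.1 (this y)).2

namespace WeakACMStructure

/-- The derivative of `φ` along `X`, as a combination of smooth functions. -/
theorem mvfderiv_eq_η_mlieBracket (S : WeakACMStructure I M) {φ : M → ℝ} (hφ : ContMDiff I 𝓘(ℝ) ∞ φ)
    (X : Π x : M, TangentSpace I x) :
    (fun y => mvfderiv I φ y (X y)) =
      appForm S.η (mlieBracket I X (φ • fun y => S.ξ y))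
        - φ * appForm S.η (mlieBracket I X fun y => S.ξ y) := by
  ext y
  -- Since `[X, φξ] = X(φ) ξ + φ [X, ξ]` and `η(ξ) = 1`, applying `η` isolates `X(φ)`. Regularity of
  -- `X(φ)` thus follows from that of brackets.
  have := mlieBracket_smul_right (V := X) (hφ.mdifferentiableAt (by simp) (x := y))
    (S.mdifferentiableAt_ξ y)
  simp [appForm, this, S.η_ξ]

theorem mdifferentiableAt_mvfderiv (S : WeakACMStructure I M) {φ : M → ℝ} (hφ : ContMDiff I 𝓘(ℝ) ∞ φ)
    (hX : CMDiff ∞ (T% X)) (x : M) : MDiffAt (fun y => mvfderiv I φ y (X y)) x := by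
  rw [S.mvfderiv_eq_η_mlieBracket hφ X]
  have h1 := contMDiff_mlieBracket hX (contMDiff_smul_vectorField hφ S.ξ)
  have h2 := contMDiff_mlieBracket hX S.ξ.contMDiff
  exact (mdifferentiableAt_appForm S.η (h1.mdifferentiableAt (by simp))).sub
    ((hφ.mdifferentiableAt (by simp)).mul
      (mdifferentiableAt_appForm S.η (h2.mdifferentiableAt (by simp))))

/-- The Lie bracket acts on smooth functions as a commutator. -/
theorem mvfderiv_mlieBracket (S : WeakACMStructure I M) {φ : M → ℝ} (hφ : ContMDiff I 𝓘(ℝ) ∞ φ)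
    (hX : CMDiff ∞ (T% X)) (hY : CMDiff ∞ (T% Y)) (x : M) :
    mvfderiv I φ x (mlieBracket I X Y x) =
      mvfderiv I (fun y => mvfderiv I φ y (Y y)) x (X x)
        - mvfderiv I (fun y => mvfderiv I φ y (X y)) x (Y x) := by
  have := isManifold_minSmoothness (I := I) (M := M) 3
  let ξ : Π x : M, TangentSpace I x := fun y => S.ξ y
  have hξ : CMDiff ∞ (T% ξ) := S.ξ.contMDiff
  have hle : minSmoothness ℝ 2 ≤ ∞ := by
    rw [minSmoothness_of_isRCLikeNormedField]
    exact WithTop.coe_le_coe.2 (le_top : (2 : ℕ∞) ≤ ⊤)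
  have hφξ : CMDiff ∞ (T% (φ • ξ)) := contMDiff_smul_vectorField hφ S.ξ
  have hd : ∀ {Z : Π x : M, TangentSpace I x}, CMDiff ∞ (T% Z) → ∀ y, MDiffAt (T% Z) y :=
    fun hZ y => hZ.mdifferentiableAt (by simp)
  have hφd : ∀ y, MDiffAt φ y := fun y => hφ.mdifferentiableAt (by simp)
  -- The Jacobi identity for `X, Y, φξ`, reduced by `φ` times the one for `X, Y, ξ`, leaves the
  -- commutator formula times `ξ`; `η` extracts the coefficient.
  have J := leibniz_identity_mlieBracket_apply (I := I) (x := x) ((hX x).of_le hle)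
    ((hY x).of_le hle) ((hφξ x).of_le hle)
  have J' := leibniz_identity_mlieBracket_apply (I := I) (x := x) ((hX x).of_le hle)
    ((hY x).of_le hle) ((hξ x).of_le hle)
  have expand : ∀ {Z : Π x : M, TangentSpace I x}, CMDiff ∞ (T% Z) →
      mlieBracket I Z (φ • ξ) = (fun y => mvfderiv I φ y (Z y)) • ξ + φ • mlieBracket I Z ξ :=
    fun {Z} hZ => by
      ext1 y
      exact mlieBracket_smul_right (V := Z) (hφd y) (hd hξ y)
  have expand2 : ∀ {Z W : Π x : M, TangentSpace I x}, CMDiff ∞ (T% Z) → CMDiff ∞ (T% W) →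
      mlieBracket I W (mlieBracket I Z (φ • ξ)) x =
        (mvfderiv I (fun y => mvfderiv I φ y (Z y)) x (W x) • ξ x
          + mvfderiv I φ x (Z x) • mlieBracket I W ξ x)
        + (mvfderiv I φ x (W x) • mlieBracket I Z ξ x
          + φ x • mlieBracket I W (mlieBracket I Z ξ) x) := fun {Z W} hZ hW => by
    have hZξ := hd (contMDiff_mlieBracket hZ hξ) x
    have hm := S.mdifferentiableAt_mvfderiv hφ hZ x
    rw [expand hZ, mlieBracket_add_right (hm.smul_section (hd hξ x))
      ((hφd x).smul_section hZξ), mlieBracket_smul_right hm (hd hξ x),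
      mlieBracket_smul_right (hφd x) hZξ]
  rw [expand2 hY hX, expand2 hX hY, expand (contMDiff_mlieBracket hX hY), J'] at J
  have J := congrArg (S.η x) J
  have hηξ : S.η x (ξ x) = 1 := S.η_ξ x
  simp only [Pi.add_apply, Pi.smul_apply', map_add, map_smul, smul_eq_mul, hηξ] at J
  linarith

/-- Second derivatives cancel by the commutator formula, the derivatives of `η([·,·])` cancel in
pairs, and what remains is `η` of the Jacobi sum. -/
theorem dTwoForm_dOneForm_η (S : WeakACMStructure I M) (X Y Z : VectorFieldSec I M) (x : M) :
    dTwoForm X Y Z x (fun y v w => dOneForm S.η y v w) = 0 := by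
  have := isManifold_minSmoothness (I := I) (M := M) 3
  have hle : minSmoothness ℝ 2 ≤ ∞ := by
    rw [minSmoothness_of_isRCLikeNormedField]
    exact WithTop.coe_le_coe.2 (le_top : (2 : ℕ∞) ≤ ⊤)
  have hd : ∀ {Z : Π x : M, TangentSpace I x}, CMDiff ∞ (T% Z) → ∀ y, MDiffAt (T% Z) y :=
    fun hZ y => hZ.mdifferentiableAt (by simp)
  have J := congrArg (S.η x) (leibniz_identity_mlieBracket_apply (I := I) (x := x)
    ((X.contMDiff x).of_le hle) ((Y.contMDiff x).of_le hle) ((Z.contMDiff x).of_le hle))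
  have hX := X.contMDiff
  have hY := Y.contMDiff
  have hZ := Z.contMDiff
  have main : ∀ {U V W : Π x : M, TangentSpace I x}, CMDiff ∞ (T% U) → CMDiff ∞ (T% V) →
      CMDiff ∞ (T% W) →
      mvfderiv I (fun y => dOneForm S.η y (V y) (W y)) x (U x) = (1 / 2) *
        (mvfderiv I (fun y => mvfderiv I (appForm S.η W) y (V y)) x (U x)
          - mvfderiv I (fun y => mvfderiv I (appForm S.η V) y (W y)) x (U x)
          - mvfderiv I (appForm S.η (mlieBracket I V W)) x (U x)) := fun {U V W} hU hV hW => by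
    have e : (fun y => dOneForm S.η y (V y) (W y)) = (fun _ => (1 / 2 : ℝ)) *
        ((fun y => mvfderiv I (appForm S.η W) y (V y))
          - (fun y => mvfderiv I (appForm S.η V) y (W y)) - appForm S.η (mlieBracket I V W)) := by
      ext y
      exact dOneForm_apply S.η (hd hV y) (hd hW y)
    have h1 := S.mdifferentiableAt_mvfderiv (contMDiff_appForm S.η hW) hV x
    have h2 := S.mdifferentiableAt_mvfderiv (contMDiff_appForm S.η hV) hW x
    have h3 := mdifferentiableAt_appForm S.η (hd (contMDiff_mlieBracket hV hW) x)
    rw [e, mvfderiv_mul mdifferentiableAt_const ((h1.sub h2).sub h3), mvfderiv_const,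
      mvfderiv_sub (h1.sub h2) h3, mvfderiv_sub h1 h2]
    simp
  have bracket : ∀ {U V W : Π x : M, TangentSpace I x}, CMDiff ∞ (T% U) → CMDiff ∞ (T% V) →
      CMDiff ∞ (T% W) →
      dOneForm S.η x (mlieBracket I U V x) (W x) = (1 / 2) *
        (mvfderiv I (fun y => mvfderiv I (appForm S.η W) y (V y)) x (U x)
          - mvfderiv I (fun y => mvfderiv I (appForm S.η W) y (U y)) x (V x)
          - mvfderiv I (appForm S.η (mlieBracket I U V)) x (W x)
          - S.η x (mlieBracket I (mlieBracket I U V) W x)) := fun {U V W} hU hV hW => by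
    rw [dOneForm_apply S.η (hd (contMDiff_mlieBracket hU hV) x) (hd hW x),
      S.mvfderiv_mlieBracket (contMDiff_appForm S.η hW) hU hV]
  rw [dTwoForm, main hX hY hZ, main hY hZ hX, main hZ hX hY, bracket hX hY hZ, bracket hZ hX hY,
    bracket hY hZ hX]
  rw [mlieBracket_swap_apply (V := X) (W := mlieBracket I Y Z),
    mlieBracket_swap_apply (V := Y) (W := mlieBracket I X Z)] at J
  have e : mlieBracket I (mlieBracket I (fun y => Z y) (fun y => X y)) (fun y => Y y) x =
      - mlieBracket I (mlieBracket I (fun y => X y) (fun y => Z y)) (fun y => Y y) x := by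
    rw [mlieBracket_swap (V := fun y => Z y) (W := fun y => X y)]
    have := mlieBracket_const_smul_left (I := I) (c := (-1 : ℝ)) (W := fun y => Y y)
      (hd (contMDiff_mlieBracket hX hZ) x)
    simpa using this
  rw [e]
  simp only [map_add, map_neg] at J ⊢
  linarith

end WeakACMStructure

end Geometry

end WeakContact

/-! ### Contactness of `η` and closedness of `Φ` -/

namespace WeakContact.WeakACMStructure

variable {n : ℕ} {M : Type*} [TopologicalSpace M]
  [ChartedSpace (EuclideanSpace ℝ (Fin (2 * n + 1))) M] [IsManifold (𝓡 (2 * n + 1)) ∞ M]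
  {S : WeakACMStructure (𝓡 (2 * n + 1)) M}

theorem finrank_tangentSpace (x : M) :
    Module.finrank ℝ (TangentSpace (𝓡 (2 * n + 1)) x) = 2 * n + 1 :=
  finrank_euclideanSpace_fin

theorem IsQuasiContact.identity (hS : S.IsQuasiContact) (x : M)
    (X Y : TangentSpace (𝓡 (2 * n + 1)) x) :
    nabla S.g S.f x X Y + nabla S.g S.f x (S.f x X) (S.f x Y) =
      (2 * S.g.inner x X Y) • S.ξ x
        - S.g.inner x (S.ξ x) Y • (X + S.h x X + S.g.inner x (S.ξ x) X • S.ξ x) := by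
  rw [← S.η_eq, ← S.η_eq]
  exact hS x X Y

theorem IsQuasiContact.f_ξ (hS : S.IsQuasiContact) (x : M) : S.f x (S.ξ x) = 0 :=
  f_xi_eq_zero_of_quasiContact (G := metricForm S.g x)
    (f := (S.f x : TangentSpace _ x →ₗ[ℝ] TangentSpace _ x))
    (h := (S.h x : TangentSpace _ x →ₗ[ℝ] TangentSpace _ x))
    (B := (leviCivita S.g S.ξ x : TangentSpace _ x →ₗ[ℝ] TangentSpace _ x))
    (T := nabla S.g S.f x) (S.g.symm x) (S.g.pos x)
    (by rw [finrank_tangentSpace]; exact odd_two_mul_add_one n) (S.inner_ξ_ξ x)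
    (S.f_skew x) (nabla_skew S.g S.f_skew) (nabla_zero_left S.g S.f) (hS.identity x) S.two_smul_h

theorem IsQuasiContact.f_sq_and_leviCivita_ξ (hS : S.IsQuasiContact)
    (hQ : ∀ (x : M) (X Y : TangentSpace (𝓡 (2 * n + 1)) x), S.η x X = 0 → S.η x Y = 0 →
      nabla S.g S.Q x X Y = 0)
    (hh : S.IsSelfAdjointH) (x : M) :
    (∀ v, S.f x (S.f x v) = - v + S.g.inner x (S.ξ x) v • S.ξ x) ∧
      ∀ v w, S.g.inner x (leviCivita S.g S.ξ x v) w - S.g.inner x v (leviCivita S.g S.ξ x w) =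
        2 * S.g.inner x v (S.f x w) :=
  quasiContact_pointwise (G := metricForm S.g x)
    (f := (S.f x : TangentSpace _ x →ₗ[ℝ] TangentSpace _ x))
    (h := (S.h x : TangentSpace _ x →ₗ[ℝ] TangentSpace _ x))
    (B := (leviCivita S.g S.ξ x : TangentSpace _ x →ₗ[ℝ] TangentSpace _ x))
    (Q := (S.Q x : TangentSpace _ x →ₗ[ℝ] TangentSpace _ x))
    (T := nabla S.g S.f x) (S.g.symm x) (S.g.pos x) (S.inner_ξ_ξ x)
    (S.f_skew x) (hS.f_ξ x) (S.Q_nonsingular x).1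
    (fun v => (S.f_sq x v).trans (by rw [S.η_eq]; rfl))
    (nabla_skew S.g S.f_skew) (nabla_zero_left S.g S.f) (S.nabla_f_ξ hS.f_ξ)
    S.inner_ξ_leviCivita_ξ (hS.identity x) S.two_smul_h (hh x)
    (fun v w hv hw => (S.nabla_Q v w).symm.trans
      (hQ x v w ((S.η_eq x v).trans hv) ((S.η_eq x w).trans hw)))

/-- If `dη` is `g(·, f ·)`, where `f² = - id + η ⊗ ξ`, then `η` is a contact form. -/
theorem isContactForm_of_dOneForm_eq (hfξ : ∀ x, S.f x (S.ξ x) = 0)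
    (hff : ∀ x v, S.f x (S.f x v) = - v + S.g.inner x (S.ξ x) v • S.ξ x)
    (hd : ∀ x v w, dOneForm S.η x v w = S.Φ x v w) : IsContactForm n S.η := by
  intro x
  let Ω : LinearMap.BilinForm ℝ (TangentSpace (𝓡 (2 * n + 1)) x) :=
    LinearMap.mk₂ ℝ (fun v w => dOneForm S.η x v w) (by simp) (by simp) (by simp) (by simp)
  have hnd : ∀ w, S.η x w = 0 → w ≠ 0 → ∃ u, S.η x u = 0 ∧ Ω w u ≠ 0 := fun w hw h0 => by
    -- The witness lies in `ker η` because `f` is skew and `f ξ = 0`, and `dη(w, f w) = g(w, f² w) =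
    -- -|w|²`.
    refine ⟨S.f x w, ?_, ?_⟩
    · have := S.f_skew x (S.ξ x) w
      rw [hfξ] at this
      rw [S.η_eq]
      simpa using this.symm
    · change dOneForm S.η x w (S.f x w) ≠ 0
      rw [hd, Φ, hff, ← S.η_eq, hw, zero_smul, add_zero, map_neg]
      exact neg_ne_zero.2 (S.g.pos x w h0).ne'
  obtain ⟨e, f, he, hf, hee, hff', hef⟩ := exists_symplectic_family
    (S.η x : TangentSpace (𝓡 (2 * n + 1)) x →ₗ[ℝ] ℝ) Ω (fun v => dOneForm_alt S.η v) hnd (n := n)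
    (by rw [finrank_tangentSpace]; omega)
  refine exists_wedgePow_ne_zero (ξ := S.ξ x) (e := e) (f := f) (S.η_ξ x) he hf hee hff' hef
    fun i j => ?_
  have h1 : Ω (f i) (e j) = - Ω (e j) (f i) :=
    (LinearMap.IsAlt.neg (B := Ω) (fun v => dOneForm_alt S.η v) (e j) (f i)).symm
  change Ω (f i) (e j) = _
  rw [h1, hef]
  by_cases hij : i = j <;> simp [hij, eq_comm]

end WeakContact.WeakACMStructure

theorem proposition3p4 (n : ℕ) (M : Type*) [TopologicalSpace M] [T2Space M]
    [ChartedSpace (EuclideanSpace ℝ (Fin (2 * n + 1))) M] [IsManifold (𝓡 (2 * n + 1)) ∞ M]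
    (S : WeakContact.WeakACMStructure (𝓡 (2 * n + 1)) M)
    (hS : S.IsQuasiContact)
    (hQ : ∀ (x : M) (X Y : TangentSpace (𝓡 (2 * n + 1)) x), S.η x X = 0 → S.η x Y = 0 →
      WeakContact.nabla S.g S.Q x X Y = 0)
    (hh : S.IsSelfAdjointH) :
    WeakContact.IsContactForm n S.η ∧
      ∀ (X Y Z : WeakContact.VectorFieldSec (𝓡 (2 * n + 1)) M) (x : M),
        WeakContact.dTwoForm X Y Z x S.Φ = 0 := by

  have key := hS.f_sq_and_leviCivita_ξ hQ hh
  have hd : ∀ x v w, WeakContact.dOneForm S.η x v w = S.Φ x v w := fun x v w => by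
    rw [S.dOneForm_η, (key x).2, WeakContact.WeakACMStructure.Φ]
    ring
  refine ⟨WeakContact.WeakACMStructure.isContactForm_of_dOneForm_eq hS.f_ξ
    (fun x => (key x).1) hd, fun X Y Z x => ?_⟩
  have e : S.Φ = fun y v w => WeakContact.dOneForm S.η y v w := by
    funext y v w
    exact (hd y v w).symm
  rw [e]
  exact S.dTwoForm_dOneForm_η X Y Z x
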